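/- Let $p$ be a prime number, let $n\ge 2$ and $k,r\ge 0$ be integers, let $\epsilon_1,\epsilon_2\in\{-1,+1\}$, and let $$f(x)=x^n+p^r\epsilon_1x+p^k\epsilon_2 .$$ Irreducibility is over $\mathbb{Z}$ (equivalently, since $f$ is monic, over $\mathbb{Q}$), and a polynomial $g\in\mathbb{Z}[x]$ is called reciprocal if $x^{\deg g}g(1/x)=\pm g(x)$. (a) Suppose that $r\in\{0,1\}$ or $k\in\{0,1\}$, and that $f$ is none of the four polynomials $x^2\pm2x-8$, $x^3-2x\pm4$. If $f$ is reducible, then $f=f_c f_n$ with $f_c,f_n\in\mathbb{Z}[x]$, where $f_c$ is a product of cyclotomic polynomials and $f_n$ is either $1$ or an irreducible non-reciprocal polynomial. (b) If $k\ge2$, $r\ge2$ and $f(x)\ne x^2+2^r\epsilon_1x-2^{2r+1}$, then $f$ is irreducible except possibly when $\frac{k}{n}\le r\le k(n-1)$. -/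

import Mathlib

open Polynomial

/-- The trinomial `x ^ n + p ^ r * ε₁ * x + p ^ k * ε₂` with integer coefficients. -/
noncomputable def primePowerTrinomial (p n r k : ℕ) (ε₁ ε₂ : ℤ) : ℤ[X] :=
  X ^ n + C ((p : ℤ) ^ r * ε₁) * X + C ((p : ℤ) ^ k * ε₂)

/-- `g` is a (finite, possibly empty) product of cyclotomic polynomials `Φ_m`, `m ≥ 1`,
with repetitions allowed. -/
def IsCyclotomicProduct (g : ℤ[X]) : Prop :=
  ∃ s : Multiset ℕ, (∀ m ∈ s, 1 ≤ m) ∧ g = (s.map fun m => cyclotomic m ℤ).prod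

/-- `g` is reciprocal if `g = ± g̃`, where `g̃ = x ^ (deg g) * g (1 / x)`. Mathlib's `reverse`
is `g̃`. -/
def IsReciprocalPoly (g : ℤ[X]) : Prop :=
  g.reverse = g ∨ g.reverse = -g

/-! Write `f = x^n + Ax + B` and suppose `f = gq` with `g`, `q` monic and nontrivial. The constant
terms are `±` powers of `p`, so the `p`-adic sizes of the roots (Newton polygon) determine `|g(0)|`
and `|q(0)|`, and the product of the roots then bounds the modulus of some complex root.

If `rn > k(n-1)`, all roots have valuation `k/n`, so both factors have a complex root of modulus at
most `ρ = p^(k/n)`; but two roots cannot both lie inside that disc when `|A|` is at least `2ρ^(n-1)`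
(`le_norm_or_le_norm_of_dvd`). If `rn < k(n-1)`, at most one root has valuation other than
`r/(n-1)`, so one factor avoids it and has a complex root `z` with `|z|^(n-1) ≤ p^r`, too small to
balance `p^k`. This gives (b) and much of (a).

What remains lies on the boundary. When one coefficient is `±2` and the other `±1`, equality in the
triangle inequality makes `±1` a root, to be split off. When both are `±1`, Ljunggren's comparison
of `f` with its mirror yields a factor `Φ₃` or `Φ₆`. When `r = 1` and `k ≥ 2`, the Newton polygon
forces an integer root `±p^j`, hence a vanishing sum of three signed powers of `p`. When `k = 1` and
`r ≥ 1`, Eisenstein applies. -/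

/-! ### Pairs of roots and products of roots -/

theorem sum_pow_mul_pow_eq_neg_of_dvd {R : Type*} [CommRing R] [IsDomain R] {n : ℕ} {A B α β : R}
    (h : (X - C α) * (X - C β) ∣ X ^ n + C A * X + C B) :
    ∑ i ∈ Finset.range n, β ^ i * α ^ (n - 1 - i) = -A := by
  obtain ⟨w, hw⟩ := h
  have h0 : α ^ n + A * α + B = 0 := by
    simpa using congrArg (eval α) hw
  -- Cancelling `X - α` and evaluating at `β` avoids dividing by `β - α`, so double roots are
  -- covered.
  have h1 : (X - C α) * (∑ i ∈ Finset.range n, X ^ i * (C α) ^ (n - 1 - i) + C A) =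
      (X - C α) * ((X - C β) * w) := by
    rw [← mul_assoc, ← hw, mul_add, mul_comm (X - C α), geom_sum₂_mul]
    have h2 : (C α ^ n + C A * C α + C B : R[X]) = 0 := by
      simp only [← C_pow, ← C_mul, ← C_add, h0, C_0]
    linear_combination -h2
  have h3 := mul_left_cancel₀ (X_sub_C_ne_zero α) h1
  have h4 := congrArg (eval β) h3
  simp [eval_finsetSum] at h4
  linear_combination h4

theorem norm_coeff_zero_eq_prod_roots {K : Type*} [NormedField K] [IsAlgClosed K] {g : ℤ[X]}
    (hg : g.Monic) :
    ‖((g.coeff 0 : ℤ) : K)‖ = ((g.map (Int.castRingHom K)).roots.map norm).prod := by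
  have h := (IsAlgClosed.splits (g.map (Int.castRingHom K))).coeff_zero_eq_prod_roots_of_monic
    (hg.map _)
  rw [coeff_map, eq_intCast] at h
  rw [h, norm_mul, norm_pow, norm_neg, norm_one, one_pow, one_mul]
  exact map_multiset_prod (normHom : K →*₀ ℝ) _

theorem card_roots_map_intCast {K : Type*} [NormedField K] [IsAlgClosed K] {g : ℤ[X]}
    (hg : g.Monic) : Multiset.card (g.map (Int.castRingHom K)).roots = g.natDegree := by
  rw [← (IsAlgClosed.splits _).natDegree_eq_card_roots, hg.natDegree_map]

theorem Multiset.prod_map_pow_eq_pow_card {ι : Type*} {s : Multiset ι} {f : ι → ℝ} {e : ℕ} {c : ℝ}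
    (h : ∀ i ∈ s, f i ^ e = c) : (s.map f).prod ^ e = c ^ Multiset.card s := by
  induction s using Multiset.induction_on with
  | empty => simp
  | cons a s ih =>
    simp only [Multiset.map_cons, Multiset.prod_cons, Multiset.card_cons, mul_pow, pow_succ]
    rw [ih fun i hi => h i (Multiset.mem_cons_of_mem hi), h a (Multiset.mem_cons_self a s),
      mul_comm]

theorem Multiset.pow_card_le_prod_map_pow {ι : Type*} {s : Multiset ι} {f : ι → ℝ} {e : ℕ} {c : ℝ}
    (hc : 0 ≤ c) (h : ∀ i ∈ s, c ≤ f i ^ e) : c ^ Multiset.card s ≤ (s.map f).prod ^ e := by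
  induction s using Multiset.induction_on with
  | empty => simp
  | cons a s ih =>
    simp only [Multiset.map_cons, Multiset.prod_cons, Multiset.card_cons, mul_pow, pow_succ]
    rw [mul_comm]
    exact mul_le_mul (h a (Multiset.mem_cons_self a s))
      (ih fun i hi => h i (Multiset.mem_cons_of_mem hi)) (pow_nonneg hc _)
      (hc.trans (h a (Multiset.mem_cons_self a s)))

theorem Multiset.pow_card_lt_prod_map_pow {ι : Type*} {s : Multiset ι} {f : ι → ℝ} {e : ℕ} {c : ℝ}
    (hc : 0 < c) (hs : s ≠ 0) (h : ∀ i ∈ s, c < f i ^ e) :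
    c ^ Multiset.card s < (s.map f).prod ^ e := by
  obtain ⟨a, ha⟩ := Multiset.exists_mem_of_ne_zero hs
  obtain ⟨t, rfl⟩ := Multiset.exists_cons_of_mem ha
  simp only [Multiset.map_cons, Multiset.prod_cons, Multiset.card_cons, mul_pow, pow_succ]
  rw [mul_comm]
  exact mul_lt_mul (h a ha)
    (Multiset.pow_card_le_prod_map_pow hc.le fun i hi => (h i (Multiset.mem_cons_of_mem hi)).le)
    (pow_pos hc _) (hc.le.trans (h a ha).le)

theorem norm_coeff_zero_pow_eq {K : Type*} [NormedField K] [IsAlgClosed K] {g : ℤ[X]}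
    (hg : g.Monic) {e : ℕ} {c : ℝ}
    (h : ∀ z : K, aeval z g = 0 → ‖z‖ ^ e = c) :
    ‖((g.coeff 0 : ℤ) : K)‖ ^ e = c ^ g.natDegree := by
  rw [norm_coeff_zero_eq_prod_roots hg, ← card_roots_map_intCast (K := K) hg]
  refine Multiset.prod_map_pow_eq_pow_card fun z hz => h z ?_
  have := (mem_roots'.1 hz).2
  rwa [IsRoot, eval_map, ← algebraMap_int_eq] at this

/-- The root moduli multiply to `|g(0)|`, so they cannot all exceed their permitted geometric mean.
The exponent `e` avoids fractional powers. -/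
theorem exists_root_norm_pow_le {g : ℤ[X]} (hg : g.Monic) (hd : g ≠ 1) {e : ℕ} {c : ℝ} (hc : 0 < c)
    (h : |(g.coeff 0 : ℝ)| ^ e ≤ c ^ g.natDegree) : ∃ z : ℂ, aeval z g = 0 ∧ ‖z‖ ^ e ≤ c := by
  by_contra! hcon
  have h1 := norm_coeff_zero_eq_prod_roots (K := ℂ) hg
  rw [Complex.norm_intCast] at h1
  rw [h1, ← card_roots_map_intCast (K := ℂ) hg] at h
  refine absurd (Multiset.pow_card_lt_prod_map_pow hc ?_ fun z hz => hcon z ?_) h.not_gt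
  · rw [Ne, ← Multiset.card_eq_zero, card_roots_map_intCast hg, hg.natDegree_eq_zero]
    exact hd
  · have := (mem_roots'.1 hz).2
    rwa [IsRoot, eval_map, ← algebraMap_int_eq] at this

/-! ### Newton polygon of a trinomial, via the ultrametric inequality -/

section Nonarchimedean

variable {K : Type*} [NormedField K] [IsUltrametricDist K] {n : ℕ} {A B z : K}

/-- The middle point lies below the chord. If `z^n` dominated `Az`, then `‖z‖^n ≤ ‖B‖`,
contradicting `hAB`. -/
theorem norm_pow_le_of_trinomial_root (hn : 2 ≤ n) (hAB : ‖B‖ ^ (n - 1) < ‖A‖ ^ n)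
    (hz : z ^ n + A * z + B = 0) : ‖z‖ ^ (n - 1) ≤ ‖A‖ := by
  obtain ⟨m, rfl⟩ : ∃ m, n = m + 1 := ⟨n - 1, by omega⟩
  rw [Nat.add_sub_cancel] at *
  by_contra! hcon
  have hz0 : 0 < ‖z‖ := by
    rcases (norm_nonneg z).eq_or_lt with h | h
    · rw [← h, zero_pow (by omega)] at hcon
      exact absurd hcon (norm_nonneg A).not_gt
    · exact h
  have h1 : ‖z‖ ^ (m + 1) ≤ max ‖A * z‖ ‖B‖ := by
    rw [← norm_pow, show z ^ (m + 1) = -(A * z + B) by linear_combination hz, norm_neg]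
    exact IsUltrametricDist.norm_add_le_max _ _
  have h2 : ‖A * z‖ < ‖z‖ ^ (m + 1) := by
    rw [norm_mul, pow_succ]
    exact mul_lt_mul_of_pos_right hcon hz0
  have h3 : ‖z‖ ^ (m + 1) ≤ ‖B‖ := (le_max_iff.1 h1).resolve_left h2.not_ge
  have h4 : (‖z‖ ^ (m + 1)) ^ m ≤ ‖B‖ ^ m := pow_le_pow_left₀ (by positivity) h3 _
  have h5 : ‖A‖ ^ (m + 1) ≤ (‖z‖ ^ m) ^ (m + 1) := pow_le_pow_left₀ (norm_nonneg _) hcon.le _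
  rw [← pow_mul] at h4 h5
  rw [mul_comm] at h5
  linarith

/-- The middle point lies above the chord, so there is a single slope: `Az` can never catch up with
`B`. -/
theorem norm_pow_eq_of_trinomial_root (hn : 2 ≤ n) (hAB : ‖A‖ ^ n < ‖B‖ ^ (n - 1))
    (hz : z ^ n + A * z + B = 0) : ‖z‖ ^ n = ‖B‖ := by
  have hzn : ‖z‖ ^ n = ‖A * z + B‖ := by
    rw [← norm_pow, show z ^ n = -(A * z + B) by linear_combination hz, norm_neg]
  obtain ⟨m, rfl⟩ : ∃ m, n = m + 1 := ⟨n - 1, by omega⟩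
  rw [Nat.add_sub_cancel] at *
  have hB : 0 < ‖B‖ := by
    rcases (norm_nonneg B).eq_or_lt with h | h
    · rw [← h, zero_pow (by omega)] at hAB
      exact absurd hAB (not_lt.2 (by positivity))
    · exact h
  rcases lt_or_ge ‖A * z‖ ‖B‖ with h | h
  · rw [hzn, IsUltrametricDist.norm_add_eq_max_of_norm_ne_norm h.ne, max_eq_right h.le]
  · have h1 : ‖z‖ ^ (m + 1) ≤ ‖A‖ * ‖z‖ := by
      rw [hzn, ← norm_mul]
      exact (IsUltrametricDist.norm_add_le_max _ _).trans (max_le le_rfl h)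
    have hz0 : 0 < ‖z‖ := by
      rcases (norm_nonneg z).eq_or_lt with h' | h'
      · rw [norm_mul, ← h', mul_zero] at h
        exact absurd hB h.not_gt
      · exact h'
    have h2 : ‖z‖ ^ m ≤ ‖A‖ := by
      rw [pow_succ] at h1
      exact le_of_mul_le_mul_right h1 hz0
    have h3 : ‖B‖ ^ m ≤ ‖A‖ ^ (m + 1) := by
      calc ‖B‖ ^ m ≤ (‖A * z‖) ^ m := pow_le_pow_left₀ hB.le h _
        _ = ‖A‖ ^ m * ‖z‖ ^ m := by rw [norm_mul, mul_pow]
        _ ≤ ‖A‖ ^ m * ‖A‖ := by gcongr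
        _ = _ := (pow_succ _ _).symm
    exact absurd hAB h3.not_gt

/-- This replaces counting slopes: at most one root, with multiplicity, is strictly smaller than the
`(n-1)`-th root of `‖A‖`. -/
theorem norm_le_max_pow_of_dvd {α β : K} (hn : 2 ≤ n)
    (h : (X - C α) * (X - C β) ∣ X ^ n + C A * X + C B) :
    ‖A‖ ≤ max ‖α‖ ‖β‖ ^ (n - 1) := by
  rw [← norm_neg, ← sum_pow_mul_pow_eq_neg_of_dvd h]
  refine IsUltrametricDist.norm_sum_le_of_forall_le_of_nonneg (by positivity) fun i hi => ?_
  have hi := Finset.mem_range.1 hi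
  rw [norm_mul, norm_pow, norm_pow]
  calc ‖β‖ ^ i * ‖α‖ ^ (n - 1 - i) ≤ max ‖α‖ ‖β‖ ^ i * max ‖α‖ ‖β‖ ^ (n - 1 - i) := by
        gcongr
        · exact le_max_right _ _
        · exact le_max_left _ _
    _ = _ := by rw [← pow_add]; congr 1; omega

end Nonarchimedean

/-! ### Complex roots in a small disc -/

/-- With both roots inside, the pair identity gives `‖A‖(ρ - ‖α‖) < ρ^n - ‖α‖^n`, while the equation
for `α` gives `‖A‖‖α‖ ≤ ‖α‖^n + ρ^n`. Their sum contradicts `hA`. -/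
theorem le_norm_or_le_norm_of_dvd {n : ℕ} {A B α β : ℂ} {ρ : ℝ} (hn : 2 ≤ n) (hB : ‖B‖ = ρ ^ n)
    (hA : 2 * ρ ^ (n - 1) ≤ ‖A‖) (hB0 : B ≠ 0)
    (h : (X - C α) * (X - C β) ∣ X ^ n + C A * X + C B) : ρ ≤ ‖α‖ ∨ ρ ≤ ‖β‖ := by
  by_contra! hcon
  obtain ⟨hα, hβ⟩ := hcon
  obtain ⟨w, hw⟩ := id h
  have h0 : α ^ n + A * α + B = 0 := by
    simpa using congrArg (eval α) hw
  have hα0 : 0 < ‖α‖ := by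
    rw [norm_pos_iff]
    rintro rfl
    rw [zero_pow (by omega), mul_zero, zero_add, zero_add] at h0
    exact hB0 h0
  have hsum : ‖A‖ < ∑ i ∈ Finset.range n, ρ ^ i * ‖α‖ ^ (n - 1 - i) := by
    rw [← norm_neg, ← sum_pow_mul_pow_eq_neg_of_dvd h]
    refine (norm_sum_le _ _).trans_lt ?_
    -- Strictness comes from the term `i = 1`, where `β` occurs once; the term `i = 0` is an
    -- equality. This needs `α ≠ 0`.
    refine Finset.sum_lt_sum (fun i _ => ?_) ⟨1, Finset.mem_range.2 (by omega), ?_⟩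
    · rw [norm_mul, norm_pow, norm_pow]
      gcongr
    · rw [norm_mul, norm_pow, norm_pow]
      gcongr
  have hg := geom_sum₂_mul ρ ‖α‖ n
  have h1 : ‖A‖ * (ρ - ‖α‖) < ρ ^ n - ‖α‖ ^ n := by
    rw [← hg]
    exact mul_lt_mul_of_pos_right hsum (by linarith)
  have h2 : ‖A‖ * ‖α‖ ≤ ‖α‖ ^ n + ρ ^ n := by
    rw [← norm_mul, show A * α = -(α ^ n + B) by linear_combination h0, norm_neg, ← hB, ← norm_pow]
    exact norm_add_le _ _
  have h3 : 2 * ρ ^ n ≤ ‖A‖ * ρ := by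
    have : ρ ^ n = ρ ^ (n - 1) * ρ := by rw [← pow_succ]; congr 1; omega
    rw [this, ← mul_assoc]
    exact mul_le_mul_of_nonneg_right hA (by linarith)
  nlinarith

/-! ### Irreducibility away from the boundary cases -/

section

variable {p n r k : ℕ} {ε₁ ε₂ : ℤ}

theorem primePowerTrinomial_degree_lt (hn : 2 ≤ n) :
    (C ((p : ℤ) ^ r * ε₁) * X + C ((p : ℤ) ^ k * ε₂)).degree < (n : WithBot ℕ) := by
  refine degree_linear_le.trans_lt ?_
  exact_mod_cast hn

theorem primePowerTrinomial_natDegree (hn : 2 ≤ n) :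
    (primePowerTrinomial p n r k ε₁ ε₂).natDegree = n := by
  rw [primePowerTrinomial, add_assoc]
  rw [natDegree_add_eq_left_of_degree_lt, natDegree_X_pow]
  rw [degree_X_pow]
  exact primePowerTrinomial_degree_lt hn

theorem primePowerTrinomial_monic (hn : 2 ≤ n) :
    (primePowerTrinomial p n r k ε₁ ε₂).Monic := by
  rw [primePowerTrinomial, add_assoc]
  exact monic_X_pow_add (primePowerTrinomial_degree_lt hn)

theorem primePowerTrinomial_ne_one (hn : 2 ≤ n) :
    primePowerTrinomial p n r k ε₁ ε₂ ≠ 1 := by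
  intro h
  have := primePowerTrinomial_natDegree (p := p) (r := r) (k := k) (ε₁ := ε₁) (ε₂ := ε₂) hn
  rw [h, natDegree_one] at this
  omega

theorem primePowerTrinomial_coeff_zero (hn : 2 ≤ n) :
    (primePowerTrinomial p n r k ε₁ ε₂).coeff 0 = (p : ℤ) ^ k * ε₂ := by
  rw [coeff_zero_eq_eval_zero]
  simp [primePowerTrinomial, show n ≠ 0 by omega]

theorem aeval_primePowerTrinomial {K : Type*} [CommRing K] [Algebra ℤ K] (z : K) :
    aeval z (primePowerTrinomial p n r k ε₁ ε₂) =
      z ^ n + ((p : K) ^ r * ε₁) * z + (p : K) ^ k * ε₂ := by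
  simp [primePowerTrinomial]

theorem exists_monic_factors (hn : 2 ≤ n)
    (h : ¬ Irreducible (primePowerTrinomial p n r k ε₁ ε₂)) :
    ∃ g q : ℤ[X], g.Monic ∧ q.Monic ∧ g ≠ 1 ∧ q ≠ 1 ∧
      g * q = primePowerTrinomial p n r k ε₁ ε₂ := by
  rw [irreducible_of_monic (primePowerTrinomial_monic hn) (primePowerTrinomial_ne_one hn)] at h
  push Not at h
  obtain ⟨g, q, hg, hq, h, h1, h2⟩ := h
  exact ⟨g, q, hg, hq, h1, h2, h⟩

theorem linear_mul_linear_dvd_of_roots {K : Type*} [Field K] {g q : ℤ[X]} {α β : K}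
    (h : g * q ∣ primePowerTrinomial p n r k ε₁ ε₂) (hα : aeval α g = 0) (hβ : aeval β q = 0) :
    (X - C α) * (X - C β) ∣ X ^ n + C ((p : K) ^ r * ε₁) * X + C ((p : K) ^ k * ε₂) := by
  have h1 : (X - C α) ∣ g.map (algebraMap ℤ K) := by
    rw [dvd_iff_isRoot, IsRoot, eval_map_algebraMap, hα]
  have h2 : (X - C β) ∣ q.map (algebraMap ℤ K) := by
    rw [dvd_iff_isRoot, IsRoot, eval_map_algebraMap, hβ]
  refine (mul_dvd_mul h1 h2).trans ?_
  rw [← Polynomial.map_mul]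
  refine (Polynomial.map_dvd _ h).trans ?_
  rw [primePowerTrinomial]
  simp

theorem coeff_zero_eq_of_dvd (hp : p.Prime) (hn : 2 ≤ n) (hε₂ : ε₂ = 1 ∨ ε₂ = -1) {g : ℤ[X]}
    (h : g ∣ primePowerTrinomial p n r k ε₁ ε₂) :
    ∃ m, g.coeff 0 = (p : ℤ) ^ m ∨ g.coeff 0 = -(p : ℤ) ^ m := by
  obtain ⟨q, hq⟩ := h
  have h0 := congrArg (coeff · 0) hq
  simp only [primePowerTrinomial_coeff_zero hn, mul_coeff_zero] at h0
  have h1 : g.coeff 0 ∣ (p : ℤ) ^ k := by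
    rcases hε₂ with rfl | rfl
    · exact ⟨q.coeff 0, by linarith⟩
    · exact ⟨-q.coeff 0, by linarith⟩
  obtain ⟨m, -, hm⟩ := (dvd_prime_pow (Nat.prime_iff_prime_int.1 hp) k).1 h1
  exact ⟨m, Int.associated_iff.1 hm⟩

theorem PadicAlgCl.norm_natCast_self (p : ℕ) [Fact p.Prime] :
    ‖(p : PadicAlgCl p)‖ = (p : ℝ)⁻¹ := by
  rw [← map_natCast (algebraMap ℚ_[p] (PadicAlgCl p)), PadicAlgCl.norm_extends, Padic.norm_p]

theorem norm_pow_mul_unit {K : Type*} [NormedField K] {x : K} {e : ℤ} (he : e = 1 ∨ e = -1)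
    (j : ℕ) : ‖x ^ j * (e : K)‖ = ‖x‖ ^ j := by
  rcases he with rfl | rfl <;> simp

/-- Since `g(0)` is `±` a power of `p`, its real absolute value is the inverse of its `p`-adic one;
this carries information from `p`-adic to complex roots. -/
theorem abs_coeff_zero_pow_eq_of_padic_norm [hp : Fact p.Prime] (hn : 2 ≤ n)
    (hε₂ : ε₂ = 1 ∨ ε₂ = -1) {g : ℤ[X]} (hg : g.Monic)
    (h : g ∣ primePowerTrinomial p n r k ε₁ ε₂) {e s : ℕ}
    (hz : ∀ z : PadicAlgCl p, aeval z g = 0 → ‖z‖ ^ e = (p : ℝ)⁻¹ ^ s) :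
    |(g.coeff 0 : ℝ)| ^ e = ((p : ℝ) ^ s) ^ g.natDegree := by
  have h1 := norm_coeff_zero_pow_eq hg hz
  obtain ⟨m, hm⟩ := coeff_zero_eq_of_dvd hp.out hn hε₂ h
  have h2 : ‖((g.coeff 0 : ℤ) : PadicAlgCl p)‖ = (p : ℝ)⁻¹ ^ m := by
    rw [← PadicAlgCl.norm_natCast_self, ← norm_pow]
    rcases hm with hm | hm <;> rw [hm] <;> simp
  have h3 : |(g.coeff 0 : ℝ)| = (p : ℝ) ^ m := by
    rcases hm with hm | hm <;> rw [hm] <;> simp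
  rw [h2, ← inv_inj] at h1
  simpa only [h3, inv_pow, inv_inv] using h1

theorem abs_coeff_zero_pow_eq_of_lt [hp : Fact p.Prime] (hn : 2 ≤ n)
    (hε₁ : ε₁ = 1 ∨ ε₁ = -1) (hε₂ : ε₂ = 1 ∨ ε₂ = -1) (hrk : k * (n - 1) < r * n) {g : ℤ[X]}
    (hg : g.Monic) (h : g ∣ primePowerTrinomial p n r k ε₁ ε₂) :
    |(g.coeff 0 : ℝ)| ^ n = ((p : ℝ) ^ k) ^ g.natDegree := by
  refine abs_coeff_zero_pow_eq_of_padic_norm hn hε₂ hg h fun z hz => ?_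
  have hz' := aeval_eq_zero_of_dvd_aeval_eq_zero h hz
  rw [aeval_primePowerTrinomial] at hz'
  have hp1 : (1 : ℝ) < p := by exact_mod_cast hp.out.one_lt
  rw [norm_pow_eq_of_trinomial_root hn _ hz', norm_pow_mul_unit hε₂,
    PadicAlgCl.norm_natCast_self]
  rw [norm_pow_mul_unit hε₂, norm_pow_mul_unit hε₁, PadicAlgCl.norm_natCast_self, ← pow_mul,
    ← pow_mul]
  exact pow_lt_pow_right_of_lt_one₀ (by positivity) (inv_lt_one_of_one_lt₀ hp1) hrk

theorem abs_coeff_zero_pow_eq_or_of_lt [hp : Fact p.Prime] (hn : 2 ≤ n)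
    (hε₁ : ε₁ = 1 ∨ ε₁ = -1) (hε₂ : ε₂ = 1 ∨ ε₂ = -1) (hrk : r * n < k * (n - 1)) {g q : ℤ[X]}
    (hg : g.Monic) (hq : q.Monic) (h : g * q ∣ primePowerTrinomial p n r k ε₁ ε₂) :
    |(g.coeff 0 : ℝ)| ^ (n - 1) = ((p : ℝ) ^ r) ^ g.natDegree ∨
      |(q.coeff 0 : ℝ)| ^ (n - 1) = ((p : ℝ) ^ r) ^ q.natDegree := by
  have hp1 : (1 : ℝ) < p := by exact_mod_cast hp.out.one_lt
  have hle : ∀ z : PadicAlgCl p, aeval z (primePowerTrinomial p n r k ε₁ ε₂) = 0 →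
      ‖z‖ ^ (n - 1) ≤ (p : ℝ)⁻¹ ^ r := by
    intro z hz
    rw [aeval_primePowerTrinomial] at hz
    rw [← PadicAlgCl.norm_natCast_self, ← norm_pow_mul_unit hε₁ r]
    refine norm_pow_le_of_trinomial_root hn ?_ hz
    rw [norm_pow_mul_unit hε₂, norm_pow_mul_unit hε₁, PadicAlgCl.norm_natCast_self, ← pow_mul,
      ← pow_mul]
    exact pow_lt_pow_right_of_lt_one₀ (by positivity) (inv_lt_one_of_one_lt₀ hp1) hrk
  have hgf := (dvd_mul_right g q).trans h
  have hqf := (dvd_mul_left q g).trans h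
  by_cases hall : ∀ z : PadicAlgCl p, aeval z g = 0 → ‖z‖ ^ (n - 1) = (p : ℝ)⁻¹ ^ r
  · exact Or.inl (abs_coeff_zero_pow_eq_of_padic_norm hn hε₂ hg hgf hall)
  · push Not at hall
    obtain ⟨α, hα, hα'⟩ := hall
    -- Here `g` holds the exceptional root `α`, so every root of `q` must attain the maximum.
    refine Or.inr (abs_coeff_zero_pow_eq_of_padic_norm hn hε₂ hq hqf fun β hβ => ?_)
    have h1 := norm_le_max_pow_of_dvd hn (linear_mul_linear_dvd_of_roots h hα hβ)
    rw [norm_pow_mul_unit hε₁, PadicAlgCl.norm_natCast_self] at h1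
    have h2 := hle α (aeval_eq_zero_of_dvd_aeval_eq_zero hgf hα)
    have h3 := hle β (aeval_eq_zero_of_dvd_aeval_eq_zero hqf hβ)
    rcases max_choice ‖α‖ ‖β‖ with hm | hm
    · rw [hm] at h1
      exact absurd (le_antisymm h2 h1) hα'
    · rw [hm] at h1
      exact le_antisymm h3 h1

/-- Both `z^n` and `Az` have modulus at most `p^r‖z‖`, so `p^k ≤ 2p^r‖z‖`; the claim is its
`(n-1)`-th power. -/
theorem pow_le_of_root_norm_pow_le (hn : 2 ≤ n)
    (hε₁ : ε₁ = 1 ∨ ε₁ = -1) (hε₂ : ε₂ = 1 ∨ ε₂ = -1) {z : ℂ}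
    (hz : aeval z (primePowerTrinomial p n r k ε₁ ε₂) = 0) (h : ‖z‖ ^ (n - 1) ≤ (p : ℝ) ^ r) :
    p ^ (k * (n - 1)) ≤ 2 ^ (n - 1) * p ^ (r * n) := by
  rw [aeval_primePowerTrinomial] at hz
  have h1 : (p : ℝ) ^ k ≤ 2 * (p : ℝ) ^ r * ‖z‖ := by
    have e1 : ‖(p : ℂ) ^ k * ε₂‖ = (p : ℝ) ^ k := by
      rw [norm_pow_mul_unit hε₂, Complex.norm_natCast]
    have e2 : ‖(p : ℂ) ^ r * ε₁‖ = (p : ℝ) ^ r := by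
      rw [norm_pow_mul_unit hε₁, Complex.norm_natCast]
    calc (p : ℝ) ^ k = ‖z ^ n + (p : ℂ) ^ r * ε₁ * z‖ := by
          rw [← e1, show (p : ℂ) ^ k * ε₂ = -(z ^ n + (p : ℂ) ^ r * ε₁ * z) by
            linear_combination hz, norm_neg]
      _ ≤ ‖z‖ ^ n + (p : ℝ) ^ r * ‖z‖ := by
          refine (norm_add_le _ _).trans ?_
          rw [norm_mul, e2, norm_pow]
      _ = ‖z‖ ^ (n - 1) * ‖z‖ + (p : ℝ) ^ r * ‖z‖ := by
          rw [← pow_succ, show n - 1 + 1 = n by omega]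
      _ ≤ (p : ℝ) ^ r * ‖z‖ + (p : ℝ) ^ r * ‖z‖ := by gcongr
      _ = _ := by ring
  have h2 : (p : ℝ) ^ (k * (n - 1)) ≤ 2 ^ (n - 1) * (p : ℝ) ^ (r * n) := by
    calc (p : ℝ) ^ (k * (n - 1)) = ((p : ℝ) ^ k) ^ (n - 1) := pow_mul _ _ _
      _ ≤ (2 * (p : ℝ) ^ r * ‖z‖) ^ (n - 1) := by gcongr
      _ = 2 ^ (n - 1) * ((p : ℝ) ^ (r * (n - 1)) * ‖z‖ ^ (n - 1)) := by
          rw [mul_pow, mul_pow, mul_assoc, pow_mul]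
      _ ≤ 2 ^ (n - 1) * ((p : ℝ) ^ (r * (n - 1)) * (p : ℝ) ^ r) := by gcongr
      _ = _ := by
          rw [← pow_add]
          congr 2
          rw [← Nat.mul_succ, Nat.succ_eq_add_one, show n - 1 + 1 = n by omega]
  exact_mod_cast h2

theorem irreducible_of_pow_lt (hp : p.Prime) (hn : 2 ≤ n)
    (hε₁ : ε₁ = 1 ∨ ε₁ = -1) (hε₂ : ε₂ = 1 ∨ ε₂ = -1)
    (hlt : 2 ^ (n - 1) * p ^ (r * n) < p ^ (k * (n - 1))) :
    Irreducible (primePowerTrinomial p n r k ε₁ ε₂) := by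
  have : Fact p.Prime := ⟨hp⟩
  by_contra hirr
  obtain ⟨g, q, hg, hq, hg1, hq1, hgq⟩ := exists_monic_factors hn hirr
  have hrk : r * n < k * (n - 1) := by
    refine (Nat.pow_lt_pow_iff_right hp.one_lt).1 (lt_of_le_of_lt ?_ hlt)
    exact Nat.le_mul_of_pos_left _ (by positivity)
  have hpr : 0 < (p : ℝ) ^ r := by
    have := hp.pos
    positivity
  rcases abs_coeff_zero_pow_eq_or_of_lt hn hε₁ hε₂ hrk hg hq hgq.dvd with h | h
  · obtain ⟨z, hz, hz'⟩ := exists_root_norm_pow_le hg hg1 hpr h.le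
    refine absurd (pow_le_of_root_norm_pow_le (k := k) hn hε₁ hε₂ ?_ hz') hlt.not_ge
    exact aeval_eq_zero_of_dvd_aeval_eq_zero (Dvd.intro _ hgq) hz
  · obtain ⟨z, hz, hz'⟩ := exists_root_norm_pow_le hq hq1 hpr h.le
    refine absurd (pow_le_of_root_norm_pow_le (k := k) hn hε₁ hε₂ ?_ hz') hlt.not_ge
    exact aeval_eq_zero_of_dvd_aeval_eq_zero (Dvd.intro_left _ hgq) hz

theorem le_of_root_norm_eq (hn : 2 ≤ n) {A B z : ℂ} {ρ : ℝ} (hρ : 0 < ρ) (hB : ‖B‖ = ρ ^ n)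
    (hz : z ^ n + A * z + B = 0) (hzρ : ‖z‖ = ρ) : ‖A‖ ≤ 2 * ρ ^ (n - 1) := by
  have h : ‖A‖ * ρ ≤ 2 * ρ ^ n := by
    rw [← hzρ, ← norm_mul, show A * z = -(z ^ n + B) by linear_combination hz, norm_neg, hzρ]
    refine (norm_add_le _ _).trans ?_
    rw [norm_pow, hzρ, hB]
    linarith
  rw [show ρ ^ n = ρ ^ (n - 1) * ρ by rw [← pow_succ, show n - 1 + 1 = n by omega],
    ← mul_assoc] at h
  exact le_of_mul_le_mul_right h hρ

/-- Both factors would have a root in the open disc of radius `ρ = p^(k/n)`. The hypothesis `h2`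
removes `k = 0`, `p^r = 2`, where `‖A‖ = 2ρ^(n-1)` and a root may lie on the circle. -/
theorem irreducible_of_mul_pred_lt (hp : p.Prime) (hn : 2 ≤ n)
    (hε₁ : ε₁ = 1 ∨ ε₁ = -1) (hε₂ : ε₂ = 1 ∨ ε₂ = -1) (hlt : k * (n - 1) < r)
    (h2 : 1 ≤ k ∨ 2 < p ^ r) :
    Irreducible (primePowerTrinomial p n r k ε₁ ε₂) := by
  have : Fact p.Prime := ⟨hp⟩
  by_contra hirr
  obtain ⟨g, q, hg, hq, hg1, hq1, hgq⟩ := exists_monic_factors hn hirr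
  have hrk : k * (n - 1) < r * n := hlt.trans_le (Nat.le_mul_of_pos_right _ (by omega))
  have hp1 : (1 : ℝ) < p := by exact_mod_cast hp.one_lt
  have hp2 : (2 : ℝ) ≤ p := by exact_mod_cast hp.two_le
  obtain ⟨ρ, hρ, hρn⟩ : ∃ ρ : ℝ, 0 < ρ ∧ ρ ^ n = (p : ℝ) ^ k :=
    ⟨((p : ℝ) ^ k) ^ (n⁻¹ : ℝ), by positivity, Real.rpow_inv_natCast_pow (by positivity) (by omega)⟩
  have hB : ‖(p : ℂ) ^ k * ε₂‖ = ρ ^ n := by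
    rw [norm_pow_mul_unit hε₂, Complex.norm_natCast, hρn]
  have hB0 : (p : ℂ) ^ k * ε₂ ≠ 0 := by
    rw [← norm_pos_iff, hB]
    positivity
  have hA : 2 * ρ ^ (n - 1) < ‖(p : ℂ) ^ r * ε₁‖ := by
    rw [norm_pow_mul_unit hε₁, Complex.norm_natCast]
    rcases Nat.eq_zero_or_pos k with rfl | hk
    · rw [pow_zero] at hρn
      rw [(pow_eq_one_iff_of_nonneg hρ.le (by omega)).1 hρn, one_pow, mul_one]
      exact_mod_cast h2.resolve_left (by omega)
    · have hρ1 : 1 < ρ := by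
        by_contra! hcon
        exact absurd (pow_le_one₀ hρ.le hcon)
          (by rw [hρn]; exact (one_lt_pow₀ hp1 (by omega)).not_ge)
      have h1 : ρ ^ (n - 1) < ρ ^ n := pow_lt_pow_right₀ hρ1 (by omega)
      have h2 : k + 1 ≤ r := by nlinarith [Nat.le_mul_of_pos_right k (show 0 < n - 1 by omega)]
      calc 2 * ρ ^ (n - 1) < 2 * ρ ^ n := by linarith
        _ ≤ p * (p : ℝ) ^ k := by rw [hρn]; gcongr
        _ = (p : ℝ) ^ (k + 1) := by ring
        _ ≤ (p : ℝ) ^ r := pow_le_pow_right₀ hp1.le h2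
  have key : ∀ u : ℤ[X], u.Monic → u ≠ 1 → u ∣ primePowerTrinomial p n r k ε₁ ε₂ →
      ∃ z : ℂ, aeval z u = 0 ∧ ‖z‖ < ρ := by
    intro u hu hu1 hud
    obtain ⟨z, hz, hz'⟩ := exists_root_norm_pow_le hu hu1 (by positivity)
      (abs_coeff_zero_pow_eq_of_lt hn hε₁ hε₂ hrk hu hud).le
    refine ⟨z, hz, lt_of_le_of_ne ?_ fun he => ?_⟩
    · rw [← hρn] at hz'
      exact le_of_pow_le_pow_left₀ (by omega) hρ.le hz'
    · have := aeval_eq_zero_of_dvd_aeval_eq_zero hud hz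
      rw [aeval_primePowerTrinomial] at this
      exact absurd (le_of_root_norm_eq hn hρ hB this he) hA.not_ge
  obtain ⟨α, hα, hα'⟩ := key g hg hg1 (Dvd.intro _ hgq)
  obtain ⟨β, hβ, hβ'⟩ := key q hq hq1 (Dvd.intro_left _ hgq)
  rcases le_norm_or_le_norm_of_dvd hn hB hA.le hB0
    (linear_mul_linear_dvd_of_roots hgq.dvd hα hβ) with h | h
  · exact absurd hα' h.not_gt
  · exact absurd hβ' h.not_gt

end

/-! ### Boundary cases with coefficients 1 and 2: splitting off a root `±1` -/

section

variable {p n r k : ℕ} {ε₁ ε₂ : ℤ}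

/-- A double root `±1` would force `|A| = n`; if `1` and `-1` were both roots, parity of `n` would
force `A = 0` or `B = 0`. -/
theorem not_linear_mul_linear_dvd (hn : 2 ≤ n) (hε₂ : ε₂ = 1 ∨ ε₂ = -1) (hp : 0 < p)
    (hA : ((p : ℤ) ^ r * ε₁).natAbs ≠ n) (hA0 : ε₁ ≠ 0) {ζ ξ : ℤ}
    (hζ : ζ = 1 ∨ ζ = -1) (hξ : ξ = 1 ∨ ξ = -1) :
    ¬ (X - C ζ) * (X - C ξ) ∣ primePowerTrinomial p n r k ε₁ ε₂ := by
  intro h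
  by_cases he : ξ = ζ
  · subst he
    have hs := sum_pow_mul_pow_eq_neg_of_dvd h
    have : ∀ i ∈ Finset.range n, ξ ^ i * ξ ^ (n - 1 - i) = ξ ^ (n - 1) := by
      intro i hi
      have := Finset.mem_range.1 hi
      rw [← pow_add]
      congr 1
      omega
    rw [Finset.sum_congr rfl this, Finset.sum_const, Finset.card_range, nsmul_eq_mul] at hs
    have hs' := congrArg Int.natAbs hs
    rw [Int.natAbs_neg, Int.natAbs_mul, Int.natAbs_pow,
      show ξ.natAbs = 1 by rcases hξ with rfl | rfl <;> rfl, one_pow, mul_one,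
      Int.natAbs_natCast] at hs'
    exact hA hs'.symm
  · obtain ⟨w, hw⟩ := h
    have h1 : (primePowerTrinomial p n r k ε₁ ε₂).eval 1 = 0 := by
      rw [hw]
      rcases hζ with rfl | rfl <;> rcases hξ with rfl | rfl <;> simp at he ⊢
    have h2 : (primePowerTrinomial p n r k ε₁ ε₂).eval (-1) = 0 := by
      rw [hw]
      rcases hζ with rfl | rfl <;> rcases hξ with rfl | rfl <;> simp at he ⊢
    simp only [primePowerTrinomial, eval_add, eval_mul, eval_pow, eval_X, eval_C, one_pow,
      mul_one, mul_neg] at h1 h2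
    have hpr : (p : ℤ) ^ r * ε₁ ≠ 0 := mul_ne_zero (by positivity) hA0
    have hpk : (p : ℤ) ^ k * ε₂ ≠ 0 := mul_ne_zero (by positivity) (by omega)
    rcases neg_one_pow_eq_or ℤ n with h3 | h3 <;> rw [h3] at h2 <;> omega

/-- If the cofactor of the first `X - ζ` split again, `hroot` would supply a second such factor,
against `hsimple`. -/
theorem exists_linear_mul_irreducible (hn : 2 ≤ n)
    (hirr : ¬ Irreducible (primePowerTrinomial p n r k ε₁ ε₂))
    (hroot : ∀ g q : ℤ[X], g.Monic → q.Monic → g ≠ 1 → q ≠ 1 →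
      g * q ∣ primePowerTrinomial p n r k ε₁ ε₂ →
      ∃ ζ : ℤ, (ζ = 1 ∨ ζ = -1) ∧ X - C ζ ∣ g * q)
    (hsimple : ∀ ζ ξ : ℤ, (ζ = 1 ∨ ζ = -1) → (ξ = 1 ∨ ξ = -1) →
      ¬ (X - C ζ) * (X - C ξ) ∣ primePowerTrinomial p n r k ε₁ ε₂) :
    ∃ (ζ : ℤ) (q : ℤ[X]), (ζ = 1 ∨ ζ = -1) ∧ q.Monic ∧ Irreducible q ∧
      primePowerTrinomial p n r k ε₁ ε₂ = (X - C ζ) * q := by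
  obtain ⟨g, q, hg, hq, hg1, hq1, hgq⟩ := exists_monic_factors hn hirr
  obtain ⟨ζ, hζ, w, hw⟩ := hroot g q hg hq hg1 hq1 hgq.dvd
  rw [hgq] at hw
  have hwm : w.Monic := (monic_X_sub_C ζ).of_mul_monic_left (hw ▸ primePowerTrinomial_monic hn)
  have hw1 : w ≠ 1 := by
    rintro rfl
    rw [mul_one] at hw
    exact hirr (hw ▸ irreducible_X_sub_C ζ)
  refine ⟨ζ, w, hζ, hwm, ?_, hw⟩
  rw [irreducible_of_monic hwm hw1]
  intro u v hu hv huv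
  by_contra! hcon
  obtain ⟨ξ, hξ, hd⟩ := hroot u v hu hv hcon.1 hcon.2 (huv ▸ Dvd.intro_left _ hw.symm)
  refine hsimple ζ ξ hζ hξ ?_
  rw [hw, ← huv]
  exact mul_dvd_mul_left _ hd

theorem isCyclotomicProduct_X_sub_C {ζ : ℤ} (hζ : ζ = 1 ∨ ζ = -1) :
    IsCyclotomicProduct (X - C ζ) := by
  rcases hζ with rfl | rfl
  · exact ⟨{1}, by simp, by simp⟩
  · exact ⟨{2}, by simp, by simp⟩

theorem X_sub_C_dvd_of_aeval_eq_zero {g : ℤ[X]} {ζ : ℤ} (h : aeval (ζ : ℂ) g = 0) :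
    X - C ζ ∣ g := by
  rw [dvd_iff_isRoot, IsRoot, ← Int.cast_inj (α := ℂ), Int.cast_zero, ← h]
  simpa using (aeval_algebraMap_apply_eq_algebraMap_eval (A := ℂ) ζ g).symm

theorem Complex.eq_one_of_add_eq_two {u v : ℂ} (hu : ‖u‖ ≤ 1) (hv : ‖v‖ ≤ 1) (h : u + v = 2) :
    v = 1 := by
  have h1 : u.re ≤ 1 := (Complex.re_le_norm u).trans hu
  have h2 : v.re ≤ 1 := (Complex.re_le_norm v).trans hv
  have h3 : u.re + v.re = 2 := by simpa using congrArg Complex.re h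
  have h4 : v.re = 1 := by linarith
  have h5 : v.re * v.re + v.im * v.im ≤ 1 := by
    rw [← Complex.normSq_apply, Complex.normSq_eq_norm_sq]
    exact pow_le_one₀ (norm_nonneg _) hv
  rw [h4] at h5
  have h6 : v.im = 0 := by nlinarith
  exact Complex.ext h4 h6

theorem not_isReciprocalPoly_of_coeff_zero {q : ℤ[X]} (hq : q.Monic) (h : q.coeff 0 ≠ 1)
    (h' : q.coeff 0 ≠ -1) : ¬ IsReciprocalPoly q := by
  intro hr
  have h1 : q.reverse.coeff 0 = 1 := by rw [coeff_zero_reverse, hq.leadingCoeff]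
  rcases hr with hr | hr <;> rw [hr] at h1
  · exact h h1
  · rw [coeff_neg] at h1
    omega

/-- A root in the closed unit disc makes two numbers of modulus at most 1 sum to 2, so it equals
`-ε₁ε₂`. The cofactor has constant term `±2`, hence is not reciprocal. -/
theorem exists_factorization_of_const_two (hn : 2 ≤ n)
    (hε₁ : ε₁ = 1 ∨ ε₁ = -1) (hε₂ : ε₂ = 1 ∨ ε₂ = -1)
    (hirr : ¬ Irreducible (primePowerTrinomial 2 n 0 1 ε₁ ε₂)) :
    ∃ fc fn : ℤ[X], primePowerTrinomial 2 n 0 1 ε₁ ε₂ = fc * fn ∧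
      IsCyclotomicProduct fc ∧ Irreducible fn ∧ ¬ IsReciprocalPoly fn := by
  have : Fact (Nat.Prime 2) := ⟨Nat.prime_two⟩
  have key : ∀ u : ℤ[X], u.Monic → u ≠ 1 → u ∣ primePowerTrinomial 2 n 0 1 ε₁ ε₂ →
      |(u.coeff 0 : ℝ)| ^ (n - 1) = (((2 : ℕ) : ℝ) ^ 0) ^ u.natDegree → X - C (-ε₁ * ε₂) ∣ u := by
    intro u hu hu1 hud h
    obtain ⟨z, hz, hz'⟩ := exists_root_norm_pow_le hu hu1 (by norm_num) h.le
    rw [pow_zero] at hz'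
    have hz1 : ‖z‖ ≤ 1 := (pow_le_one_iff_of_nonneg (norm_nonneg _) (by omega)).1 hz'
    have h0 := aeval_eq_zero_of_dvd_aeval_eq_zero hud hz
    rw [aeval_primePowerTrinomial] at h0
    refine X_sub_C_dvd_of_aeval_eq_zero ?_
    rw [← hz]
    congr 2
    have e2 : (ε₂ : ℂ) * ε₂ = 1 := by rcases hε₂ with rfl | rfl <;> norm_num
    have e1 : (ε₁ : ℂ) * ε₁ = 1 := by rcases hε₁ with rfl | rfl <;> norm_num
    have n1 : ‖(ε₁ : ℂ)‖ = 1 := by rcases hε₁ with rfl | rfl <;> norm_num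
    have n2 : ‖(ε₂ : ℂ)‖ = 1 := by rcases hε₂ with rfl | rfl <;> norm_num
    have h1 := Complex.eq_one_of_add_eq_two (u := -ε₂ * z ^ n) (v := -ε₂ * ε₁ * z)
      (by rw [norm_mul, norm_neg, n2, one_mul, norm_pow]; exact pow_le_one₀ (norm_nonneg _) hz1)
      (by rw [norm_mul, norm_mul, norm_neg, n2, n1, one_mul, one_mul]; exact hz1)
      (by push_cast at h0; linear_combination (-ε₂ : ℂ) * h0 + 2 * e2)
    push_cast
    linear_combination (ε₁ * ε₂ : ℂ) * h1 + z * ε₂ * ε₂ * e1 + z * e2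
  obtain ⟨ζ, q, hζ, hq, hqi, hf⟩ := exists_linear_mul_irreducible hn hirr (fun g q hg hq hg1 hq1 h => by
      refine ⟨-ε₁ * ε₂, by rcases hε₁ with rfl | rfl <;> rcases hε₂ with rfl | rfl <;> simp, ?_⟩
      rcases abs_coeff_zero_pow_eq_or_of_lt hn hε₁ hε₂ (by omega) hg hq h with h' | h'
      · exact (key g hg hg1 ((dvd_mul_right _ _).trans h) h').mul_right _
      · exact (key q hq hq1 ((dvd_mul_left _ _).trans h) h').mul_left _)
    (fun ζ ξ hζ hξ => not_linear_mul_linear_dvd hn hε₂ two_pos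
      (by rcases hε₁ with rfl | rfl <;> simp <;> omega) (by omega) hζ hξ)
  refine ⟨X - C ζ, q, hf, isCyclotomicProduct_X_sub_C hζ, hqi, ?_⟩
  have h0 := congrArg (coeff · 0) hf
  simp only [primePowerTrinomial_coeff_zero hn, mul_coeff_zero, coeff_sub, coeff_X_zero,
    coeff_C_zero] at h0
  push_cast at h0
  apply not_isReciprocalPoly_of_coeff_zero hq
  · intro h
    rw [h] at h0
    omega
  · intro h
    rw [h] at h0
    omega

/-- Both factors have a root in the closed unit disc, and one of these lies on the circle; dividing
the equation by `z` makes it `-ε₁ε₂`. At `n = 2` this root can be double. -/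
theorem exists_factorization_of_linear_two (hn : 3 ≤ n)
    (hε₁ : ε₁ = 1 ∨ ε₁ = -1) (hε₂ : ε₂ = 1 ∨ ε₂ = -1)
    (hirr : ¬ Irreducible (primePowerTrinomial 2 n 1 0 ε₁ ε₂)) :
    ∃ fc fn : ℤ[X], primePowerTrinomial 2 n 1 0 ε₁ ε₂ = fc * fn ∧
      IsCyclotomicProduct fc ∧ Irreducible fn ∧ ¬ IsReciprocalPoly fn := by
  have : Fact (Nat.Prime 2) := ⟨Nat.prime_two⟩
  have hn2 : 2 ≤ n := by omega
  have e1 : (ε₁ : ℂ) * ε₁ = 1 := by rcases hε₁ with rfl | rfl <;> norm_num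
  have n1 : |(ε₁ : ℝ)| = 1 := by rcases hε₁ with rfl | rfl <;> simp
  have n2 : |(ε₂ : ℝ)| = 1 := by rcases hε₂ with rfl | rfl <;> simp
  have key : ∀ u : ℤ[X], u.Monic → u ≠ 1 → u ∣ primePowerTrinomial 2 n 1 0 ε₁ ε₂ →
      ∃ z : ℂ, aeval z u = 0 ∧ ‖z‖ ≤ 1 := by
    intro u hu hu1 hud
    obtain ⟨z, hz, hz'⟩ := exists_root_norm_pow_le hu hu1 (by norm_num)
      (abs_coeff_zero_pow_eq_of_lt hn2 hε₁ hε₂ (by omega) hu hud).le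
    rw [pow_zero] at hz'
    exact ⟨z, hz, (pow_le_one_iff_of_nonneg (norm_nonneg _) (by omega)).1 hz'⟩
  have key' : ∀ (u : ℤ[X]) (z : ℂ), u ∣ primePowerTrinomial 2 n 1 0 ε₁ ε₂ → aeval z u = 0 →
      ‖z‖ = 1 → X - C (-ε₁ * ε₂) ∣ u := by
    intro u z hud hz hz1
    have h0 := aeval_eq_zero_of_dvd_aeval_eq_zero hud hz
    rw [aeval_primePowerTrinomial] at h0
    push_cast at h0
    refine X_sub_C_dvd_of_aeval_eq_zero ?_
    rw [← hz]
    congr 2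
    have hz0 : z ≠ 0 := by
      rintro rfl
      simp at hz1
    have h1 := Complex.eq_one_of_add_eq_two (u := -ε₁ * z ^ n * z⁻¹) (v := -ε₁ * ε₂ * z⁻¹)
      (by simp [n1, hz1]) (by simp [n1, n2, hz1])
      (by
        field_simp
        linear_combination (-ε₁ : ℂ) * h0 + 2 * z * e1)
    push_cast
    rw [mul_inv_eq_one₀ hz0] at h1
    exact h1
  obtain ⟨ζ, q, hζ, hq, hqi, hf⟩ := exists_linear_mul_irreducible hn2 hirr
    (fun g q hg hq hg1 hq1 h => by
      refine ⟨-ε₁ * ε₂, by rcases hε₁ with rfl | rfl <;> rcases hε₂ with rfl | rfl <;> simp, ?_⟩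
      have hgd := (dvd_mul_right g q).trans h
      have hqd := (dvd_mul_left q g).trans h
      obtain ⟨α, hα, hα'⟩ := key g hg hg1 hgd
      obtain ⟨β, hβ, hβ'⟩ := key q hq hq1 hqd
      rcases le_norm_or_le_norm_of_dvd (ρ := 1) hn2 (by simp [n2]) (by simp [n1])
        (by simp; omega) (linear_mul_linear_dvd_of_roots h hα hβ) with h' | h'
      · exact (key' g α hgd hα (le_antisymm hα' h')).mul_right _
      · exact (key' q β hqd hβ (le_antisymm hβ' h')).mul_left _)
    (fun ζ ξ hζ hξ => not_linear_mul_linear_dvd hn2 hε₂ two_pos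
      (by rcases hε₁ with rfl | rfl <;> simp <;> omega) (by omega) hζ hξ)
  refine ⟨X - C ζ, q, hf, isCyclotomicProduct_X_sub_C hζ, hqi, fun hr => ?_⟩
  have hlin : (X - C ζ).reverse = X - C ζ ∨ (X - C ζ).reverse = -(X - C ζ) := by
    have h1 : (X - C ζ).reverse = 1 - C ζ * X := by
      have hX : (X : ℤ[X]).reverse = 1 := by
        rw [← mul_one (X : ℤ[X]), reverse_X_mul, ← C_1, reverse_C]
      rw [sub_eq_add_neg, ← C_neg, reverse_add_C, natDegree_X, pow_one, hX, C_neg, neg_mul,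
        ← sub_eq_add_neg]
    rw [h1]
    rcases hζ with rfl | rfl
    · right; simp
    · left; simp [add_comm]
  -- A reciprocal cofactor would make `f` reciprocal, yet for `n ≥ 3` its coefficients at `1` and `n
  -- - 1` are `±2` and `0`.
  have hrev : (primePowerTrinomial 2 n 1 0 ε₁ ε₂).reverse = primePowerTrinomial 2 n 1 0 ε₁ ε₂ ∨
      (primePowerTrinomial 2 n 1 0 ε₁ ε₂).reverse = -primePowerTrinomial 2 n 1 0 ε₁ ε₂ := by
    rw [hf, reverse_mul_of_domain]
    rcases hlin with h1 | h1 <;> rcases hr with h2 | h2 <;> rw [h1, h2] <;>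
      simp only [neg_mul, mul_neg, neg_neg, true_or, or_true]
  have hc1 : (primePowerTrinomial 2 n 1 0 ε₁ ε₂).coeff 1 = 2 * ε₁ := by
    rw [primePowerTrinomial, coeff_add, coeff_add, coeff_X_pow, coeff_C_mul, coeff_X_one, coeff_C,
      if_neg (by omega), if_neg (by omega)]
    push_cast
    ring
  have hc2 : (primePowerTrinomial 2 n 1 0 ε₁ ε₂).reverse.coeff 1 = 0 := by
    rw [coeff_reverse, primePowerTrinomial_natDegree hn2, revAt_le (by omega)]
    rw [primePowerTrinomial, coeff_add, coeff_add, coeff_X_pow, coeff_C_mul, coeff_X, coeff_C,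
      if_neg (by omega), if_neg (by omega), if_neg (by omega), mul_zero, add_zero, add_zero]
  rcases hrev with h | h <;> rw [h] at hc2
  · omega
  · rw [coeff_neg] at hc2
    omega

end

/-! ### Unit trinomials, after Ljunggren -/

theorem Polynomial.IsUnitTrinomial.eq_of_mul_mirror_eq {f w : ℤ[X]} (hf : f.IsUnitTrinomial)
    (hfw : f * f.mirror = w * w.mirror) :
    w = f ∨ w = -f ∨ w = f.mirror ∨ w = -f.mirror := by
  have hw : IsUnitTrinomial w := (isUnitTrinomial_iff'' hfw).mp hf
  obtain ⟨k, m, n, hkm, hmn, u, v, w', hp⟩ := hf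
  obtain ⟨k', m', n', hkm', hmn', x, y, z, hq⟩ := hw
  have hk : k = k' := by
    rw [← mul_right_inj' (show 2 ≠ 0 from two_ne_zero), ←
      trinomial_natTrailingDegree hkm hmn u.ne_zero, ← hp, ← natTrailingDegree_mul_mirror, hfw,
      natTrailingDegree_mul_mirror, hq, trinomial_natTrailingDegree hkm' hmn' x.ne_zero]
  have hn : n = n' := by
    rw [← mul_right_inj' (show 2 ≠ 0 from two_ne_zero), ← trinomial_natDegree hkm hmn w'.ne_zero, ←
      hp, ← natDegree_mul_mirror, hfw, natDegree_mul_mirror, hq,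
      trinomial_natDegree hkm' hmn' z.ne_zero]
  subst hk
  subst hn
  -- The middle coefficients are units, so they agree up to sign; in the second case `f` is replaced
  -- by `-f`.
  rcases eq_or_eq_neg_of_sq_eq_sq (y : ℤ) (v : ℤ)
      ((Int.isUnit_sq y.isUnit).trans (Int.isUnit_sq v.isUnit).symm) with
    (h1 | h1)
  · rw [h1] at hq
    rcases irreducible_aux3 hkm hmn hkm' hmn' u v w' x z hp hq hfw with (h2 | h2)
    · exact Or.inl h2
    · exact Or.inr (Or.inr (Or.inl h2))
  · rw [h1] at hq
    rw [trinomial_def] at hp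
    rw [← neg_inj, neg_add, neg_add, ← neg_mul, ← neg_mul, ← neg_mul, ← C_neg, ← C_neg, ← C_neg]
      at hp
    rw [← neg_mul_neg, ← mirror_neg] at hfw
    rcases irreducible_aux3 hkm hmn hkm' hmn' (-u) (-v) (-w') x z hp hq hfw with (rfl | rfl)
    · exact Or.inr (Or.inl rfl)
    · exact Or.inr (Or.inr (Or.inr f.mirror_neg))

/-- Mirroring only `u` leaves `f * f.mirror` unchanged, so `u.mirror * v` is `±f` or `±f.mirror`;
cancel. -/
theorem Polynomial.IsUnitTrinomial.mirror_eq_or_of_eq_mul {f u v : ℤ[X]} (hf : f.IsUnitTrinomial)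
    (h : f = u * v) :
    (u.mirror = u ∨ u.mirror = -u) ∨ (v.mirror = v ∨ v.mirror = -v) := by
  have hu : u ≠ 0 := by
    rintro rfl
    exact hf.ne_zero (by rw [h, zero_mul])
  have hv : v ≠ 0 := by
    rintro rfl
    exact hf.ne_zero (by rw [h, mul_zero])
  have hu' : u.mirror ≠ 0 := mt mirror_eq_zero.1 hu
  have hw : f * f.mirror = (u.mirror * v) * (u.mirror * v).mirror := by
    rw [h, mirror_mul_of_domain, mirror_mul_of_domain, mirror_mirror]
    ring
  rcases hf.eq_of_mul_mirror_eq hw with h1 | h1 | h1 | h1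
  · rw [h] at h1
    exact Or.inl (Or.inl (mul_right_cancel₀ hv h1))
  · rw [h, ← neg_mul] at h1
    exact Or.inl (Or.inr (mul_right_cancel₀ hv h1))
  · rw [h, mirror_mul_of_domain] at h1
    exact Or.inr (Or.inl (mul_left_cancel₀ hu' h1).symm)
  · rw [h, mirror_mul_of_domain, ← mul_neg] at h1
    exact Or.inr (Or.inr (neg_eq_iff_eq_neg.1 (mul_left_cancel₀ hu' h1).symm))

theorem exists_aeval_eq_zero_of_monic {u : ℤ[X]} (hu : u.Monic) (hu1 : u ≠ 1) :
    ∃ z : ℂ, aeval z u = 0 := by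
  have hd : (u.map (algebraMap ℤ ℂ)).degree ≠ 0 := by
    rw [hu.degree_map]
    intro h
    exact hu1 (hu.natDegree_eq_zero.1 (natDegree_eq_of_degree_eq_some h))
  obtain ⟨z, hz⟩ := IsAlgClosed.exists_root _ hd
  exact ⟨z, by rwa [IsRoot, eval_map_algebraMap] at hz⟩

theorem exists_cyclotomic_of_quadratic_root {c : ℤ} (hc : c = 1 ∨ c = -1) :
    ∃ m : ℕ, 1 ≤ m ∧ ∀ z : ℂ, z ^ 2 + c * z + 1 = 0 →
      ‖z‖ = 1 ∧ aeval z (cyclotomic m ℤ) = 0 ∧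
        ∀ u : ℤ[X], aeval z u = 0 → cyclotomic m ℤ ∣ u := by
  obtain ⟨m, hm, hcyc⟩ : ∃ m : ℕ, 1 ≤ m ∧ cyclotomic m ℂ = X ^ 2 + C (c : ℂ) * X + 1 := by
    rcases hc with rfl | rfl
    · exact ⟨3, by norm_num, by rw [cyclotomic_three]; simp⟩
    · exact ⟨6, by norm_num, by rw [cyclotomic_six]; simp [sub_eq_add_neg]⟩
  refine ⟨m, hm, fun z hz => ?_⟩
  have : NeZero (m : ℂ) := ⟨by exact_mod_cast (by omega : m ≠ 0)⟩
  have hprim : IsPrimitiveRoot z m := by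
    rw [← isRoot_cyclotomic_iff, hcyc, IsRoot]
    simpa using hz
  refine ⟨hprim.norm'_eq_one (by omega), ?_, fun u hu => ?_⟩
  · rw [cyclotomic_eq_minpoly hprim (by omega)]
    exact minpoly.aeval ℤ z
  · rw [cyclotomic_eq_minpoly hprim (by omega)]
    exact minpoly.isIntegrallyClosed_dvd (hprim.isIntegral (by omega)) hu

section

variable {n : ℕ} {a b : ℤ}

theorem isUnitTrinomial_X_pow_add (hn : 2 ≤ n) (ha : a = 1 ∨ a = -1) (hb : b = 1 ∨ b = -1) :
    (X ^ n + C a * X + C b).IsUnitTrinomial := by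
  obtain ⟨a', rfl⟩ : IsUnit a := Int.isUnit_iff.2 ha
  obtain ⟨b', rfl⟩ : IsUnit b := Int.isUnit_iff.2 hb
  refine ⟨0, 1, n, one_pos, by omega, b', a', 1, ?_⟩
  rw [trinomial_def]
  simp
  ring

/-- Such a `z` is a root of both `f` and its mirror. Eliminating `z^n` gives `z^(n-1) = bz`, and
substituting back leaves a quadratic. -/
theorem quadratic_root_of_mirror (hn : 2 ≤ n) (ha : a = 1 ∨ a = -1) (hb : b = 1 ∨ b = -1)
    {u : ℤ[X]} (hu : u ∣ X ^ n + C a * X + C b) (hum : u.mirror = u ∨ u.mirror = -u) {z : ℂ}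
    (hz : aeval z u = 0) : z ^ 2 + ((a * b : ℤ) : ℂ) * z + 1 = 0 := by
  have hz1 := aeval_eq_zero_of_dvd_aeval_eq_zero hu hz
  have hmir : (X ^ n + C a * X + C b).mirror = 1 + C a * X ^ (n - 1) + C b * X ^ n := by
    have : (X ^ n + C a * X + C b) = trinomial 0 1 n b a 1 := by
      rw [trinomial_def, C_1, pow_zero, pow_one]
      ring
    rw [this, trinomial_mirror one_pos (by omega) (by omega) one_ne_zero, trinomial_def, C_1,
      pow_zero, add_zero, mul_one]
  have hz2 : aeval z (1 + C a * X ^ (n - 1) + C b * X ^ n) = 0 := by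
    rw [← hmir]
    obtain ⟨v, hv⟩ := hu
    rw [hv, mirror_mul_of_domain, map_mul]
    rcases hum with h | h <;> rw [h] <;> simp [hz]
  simp at hz1 hz2
  have ea : (a : ℂ) * a = 1 := by rcases ha with rfl | rfl <;> norm_num
  have eb : (b : ℂ) * b = 1 := by rcases hb with rfl | rfl <;> norm_num
  obtain ⟨m, rfl⟩ : ∃ m, n = m + 1 := ⟨n - 1, by omega⟩
  rw [Nat.add_sub_cancel] at hz2
  have h1 : z ^ m = b * z := by
    linear_combination (-a * b : ℂ) * hz1 + a * hz2 - (z ^ m - b * z) * ea + a * eb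
  rw [pow_succ, h1] at hz1
  push_cast
  linear_combination (b : ℂ) * hz1 - z ^ 2 * eb - eb

theorem exists_factorization_of_unit_trinomial (hn : 2 ≤ n) (ha : a = 1 ∨ a = -1)
    (hb : b = 1 ∨ b = -1) (hm : (X ^ n + C a * X + C b).Monic)
    (hirr : ¬ Irreducible (X ^ n + C a * X + C b)) :
    ∃ fc fn : ℤ[X], X ^ n + C a * X + C b = fc * fn ∧ IsCyclotomicProduct fc ∧
      (fn = 1 ∨ (Irreducible fn ∧ ¬ IsReciprocalPoly fn)) := by
  have hunit := isUnitTrinomial_X_pow_add hn ha hb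
  obtain ⟨m, hm1, hcyc⟩ := exists_cyclotomic_of_quadratic_root (c := a * b)
    (by rcases ha with rfl | rfl <;> rcases hb with rfl | rfl <;> simp)
  set Φ := cyclotomic m ℤ with hΦ
  have hΦm : Φ.Monic := cyclotomic.monic m ℤ
  have hself : ∀ u : ℤ[X], u ∣ X ^ n + C a * X + C b → (u.mirror = u ∨ u.mirror = -u) →
      ∀ z : ℂ, aeval z u = 0 → ‖z‖ = 1 ∧ aeval z Φ = 0 ∧
        ∀ v : ℤ[X], aeval z v = 0 → Φ ∣ v :=
    fun u hu hum z hz => hcyc z (quadratic_root_of_mirror hn ha hb hu hum hz)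
  have hne : X ^ n + C a * X + C b ≠ 1 := by
    intro h
    rw [h] at hunit
    exact hunit.not_isUnit isUnit_one
  have hdvd : ∃ z : ℂ, (‖z‖ = 1 ∧ aeval z Φ = 0 ∧ ∀ v : ℤ[X], aeval z v = 0 → Φ ∣ v) ∧
      aeval z (X ^ n + C a * X + C b) = 0 := by
    have h := hirr
    rw [irreducible_of_monic hm hne] at h
    push Not at h
    obtain ⟨u, v, hu, hv, h, hu1, hv1⟩ := h
    have hud : u ∣ X ^ n + C a * X + C b := Dvd.intro _ h
    have hvd : v ∣ X ^ n + C a * X + C b := Dvd.intro_left _ h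
    rcases hunit.mirror_eq_or_of_eq_mul h.symm with h' | h'
    · obtain ⟨z, hz⟩ := exists_aeval_eq_zero_of_monic hu hu1
      exact ⟨z, hself u hud h' z hz, aeval_eq_zero_of_dvd_aeval_eq_zero hud hz⟩
    · obtain ⟨z, hz⟩ := exists_aeval_eq_zero_of_monic hv hv1
      exact ⟨z, hself v hvd h' z hz, aeval_eq_zero_of_dvd_aeval_eq_zero hvd hz⟩
  obtain ⟨ω, ⟨hω1, hωΦ, hωd⟩, hωf⟩ := hdvd
  obtain ⟨q, hq⟩ := hωd _ hωf
  have hqm : q.Monic := hΦm.of_mul_monic_left (hq ▸ hm)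
  -- Otherwise `ω` is a double root, so `nω^(n-1) = -a`, and `‖ω‖ = 1` gives `n = 1`.
  have hndvd : ¬ Φ ∣ q := by
    rintro ⟨w, rfl⟩
    have h1 : (X - C ω) ∣ Φ.map (algebraMap ℤ ℂ) := by
      rw [dvd_iff_isRoot, IsRoot, eval_map_algebraMap, hωΦ]
    have h2 : (X - C ω) * (X - C ω) ∣ X ^ n + C (a : ℂ) * X + C (b : ℂ) := by
      refine (mul_dvd_mul h1 h1).trans ⟨w.map (algebraMap ℤ ℂ), ?_⟩
      have := congrArg (Polynomial.map (algebraMap ℤ ℂ)) hq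
      simp only [Polynomial.map_add, Polynomial.map_mul, Polynomial.map_pow, map_X, map_C] at this
      rw [mul_assoc, ← this]
      simp
    have h3 := sum_pow_mul_pow_eq_neg_of_dvd h2
    have h4 : ∀ i ∈ Finset.range n, ω ^ i * ω ^ (n - 1 - i) = ω ^ (n - 1) := by
      intro i hi
      have := Finset.mem_range.1 hi
      rw [← pow_add]
      congr 1
      omega
    rw [Finset.sum_congr rfl h4, Finset.sum_const, Finset.card_range, nsmul_eq_mul] at h3
    have h5 := congrArg norm h3
    rw [norm_mul, norm_pow, hω1, one_pow, mul_one, norm_neg, Complex.norm_natCast,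
      Complex.norm_intCast] at h5
    have h6 : (n : ℝ) = 1 := by
      rw [h5]
      rcases ha with rfl | rfl <;> simp
    have h7 : n = 1 := by exact_mod_cast h6
    omega
  have hqd : q ∣ X ^ n + C a * X + C b := Dvd.intro_left _ hq.symm
  have hpart : ∀ u v : ℤ[X], u.Monic → u ≠ 1 → u * v = q →
      ¬ (u * Φ ∣ X ^ n + C a * X + C b ∧
        ((u * Φ).mirror = u * Φ ∨ (u * Φ).mirror = -(u * Φ))) := by
    rintro u v hu hu1 huv ⟨hd, hs⟩
    obtain ⟨z, hz⟩ := exists_aeval_eq_zero_of_monic hu hu1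
    have := (hself _ hd hs z (by rw [map_mul, hz, zero_mul])).2.2 u hz
    exact hndvd (this.trans (Dvd.intro _ huv))
  have hnself : ∀ u : ℤ[X], u.Monic → u ≠ 1 → u ∣ q → ¬ (u.mirror = u ∨ u.mirror = -u) := by
    intro u hu hu1 hud hs
    obtain ⟨z, hz⟩ := exists_aeval_eq_zero_of_monic hu hu1
    exact hndvd (((hself _ (hud.trans hqd) hs z hz).2.2 u hz).trans hud)
  refine ⟨Φ, q, hq, ⟨{m}, by simpa using hm1, by simp [hΦ]⟩, ?_⟩
  by_cases hq1 : q = 1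
  · exact Or.inl hq1
  refine Or.inr ⟨?_, fun hr => ?_⟩
  · rw [irreducible_of_monic hqm hq1]
    intro u v hu hv huv
    by_contra! hcon
    -- Attaching `Φ` to `u` makes either alternative of the mirror dichotomy put another copy of `Φ`
    -- into `q`.
    have hf : X ^ n + C a * X + C b = (u * Φ) * v := by
      rw [hq, ← huv]
      ring
    rcases hunit.mirror_eq_or_of_eq_mul hf with h | h
    · exact hpart u v hu hcon.1 huv ⟨Dvd.intro _ hf.symm, h⟩
    · exact hnself v hv hcon.2 (Dvd.intro_left _ huv) h
  · have h0 : q.coeff 0 ≠ 0 := by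
      intro h
      have h1 := congrArg (coeff · 0) hq
      simp only [mul_coeff_zero, h, mul_zero, coeff_add, coeff_C_zero, coeff_X_pow, coeff_X_zero,
        if_neg (show ¬ 0 = n by omega)] at h1
      omega
    have hmr : q.mirror = q.reverse := by
      rw [mirror, natTrailingDegree_eq_zero.2 (Or.inr h0), pow_zero, mul_one]
    refine hnself q hqm hq1 dvd_rfl ?_
    rw [hmr]
    exact hr

end

/-! ### Integer roots and vanishing sums of three signed prime powers -/

theorem Nat.Prime.pow_add_pow_eq_pow {p a b c : ℕ} (hp : p.Prime) (h : p ^ a + p ^ b = p ^ c) :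
    p = 2 ∧ a = b ∧ c = a + 1 := by
  wlog hab : a ≤ b generalizing a b
  · obtain ⟨h1, h2, h3⟩ := this (a := b) (b := a) (by rw [add_comm]; exact h) (by omega)
    exact ⟨h1, h2.symm, by omega⟩
  obtain ⟨d, rfl⟩ := Nat.exists_eq_add_of_le hab
  have hac : a < c := by
    rw [← Nat.pow_lt_pow_iff_right hp.one_lt, ← h]
    have := hp.pos
    exact Nat.lt_add_of_pos_right (by positivity)
  obtain ⟨e, rfl⟩ := Nat.exists_eq_add_of_lt hac
  have h1 : 1 + p ^ d = p ^ (e + 1) := by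
    have h2 : p ^ a * (1 + p ^ d) = p ^ a * p ^ (e + 1) := by
      rw [mul_add, mul_one, ← pow_add, ← pow_add, h, add_assoc]
    exact Nat.eq_of_mul_eq_mul_left (pow_pos hp.pos a) h2
  rcases Nat.eq_zero_or_pos d with rfl | hd
  · rw [pow_zero] at h1
    have h3 : p ^ (e + 1) = 2 ^ 1 := by omega
    have h4 : p ∣ 2 := by
      rw [← pow_one 2, ← h3]
      exact dvd_pow_self p (by omega)
    have h5 := (Nat.prime_dvd_prime_iff_eq hp Nat.prime_two).1 h4
    subst h5
    have h6 := Nat.pow_right_injective le_rfl h3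
    omega
  · exfalso
    have h3 : p ∣ 1 := by
      rw [Nat.dvd_add_iff_left (dvd_pow_self p (by omega : d ≠ 0)), h1]
      exact dvd_pow_self p (by omega)
    exact hp.one_lt.ne' (Nat.dvd_one.1 h3)

theorem Nat.Prime.signed_pow_sum_eq_zero {p a b c : ℕ} (hp : p.Prime) {s t u : ℤ}
    (hs : s = 1 ∨ s = -1) (ht : t = 1 ∨ t = -1) (hu : u = 1 ∨ u = -1)
    (h : s * (p : ℤ) ^ a + t * (p : ℤ) ^ b + u * (p : ℤ) ^ c = 0) :
    p = 2 ∧ ((a = b ∧ c = a + 1) ∨ (a = c ∧ b = a + 1) ∨ (b = c ∧ a = b + 1)) := by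
  have h0 : p ^ a + p ^ b = p ^ c ∨ p ^ a + p ^ c = p ^ b ∨ p ^ b + p ^ c = p ^ a := by
    zify
    have ha : 0 < (p : ℤ) ^ a := pow_pos (by exact_mod_cast hp.pos) _
    have hb : 0 < (p : ℤ) ^ b := pow_pos (by exact_mod_cast hp.pos) _
    have hc : 0 < (p : ℤ) ^ c := pow_pos (by exact_mod_cast hp.pos) _
    rcases hs with rfl | rfl <;> rcases ht with rfl | rfl <;> rcases hu with rfl | rfl <;> omega
  rcases h0 with h0 | h0 | h0
  · have := hp.pow_add_pow_eq_pow h0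
    exact ⟨this.1, Or.inl this.2⟩
  · have := hp.pow_add_pow_eq_pow h0
    exact ⟨this.1, Or.inr (Or.inl this.2)⟩
  · have := hp.pow_add_pow_eq_pow h0
    exact ⟨this.1, Or.inr (Or.inr this.2)⟩

section

variable {p n r k : ℕ} {ε₁ ε₂ : ℤ}

theorem exists_int_root_of_natDegree_eq_one (hp : p.Prime) (hn : 2 ≤ n) (hε₂ : ε₂ = 1 ∨ ε₂ = -1)
    {q : ℤ[X]} (hq : q.Monic) (hd : q.natDegree = 1)
    (h : q ∣ primePowerTrinomial p n r k ε₁ ε₂) :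
    ∃ (s : ℤ) (j : ℕ), (s = 1 ∨ s = -1) ∧
      (s * (p : ℤ) ^ j) ^ n + p ^ r * ε₁ * (s * (p : ℤ) ^ j) + p ^ k * ε₂ = 0 := by
  obtain ⟨m, hm⟩ := coeff_zero_eq_of_dvd hp hn hε₂ h
  have hlin : q = X + C (q.coeff 0) := hq.eq_X_add_C hd
  have hroot : ∀ x : ℤ, x = -q.coeff 0 → x ^ n + p ^ r * ε₁ * x + p ^ k * ε₂ = 0 := by
    rintro x rfl
    have h1 : aeval (-q.coeff 0) q = 0 := by
      conv_lhs => rw [hlin]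
      simp
    have h2 := aeval_eq_zero_of_dvd_aeval_eq_zero h h1
    rw [aeval_primePowerTrinomial] at h2
    simpa using h2
  rcases hm with hm | hm
  · exact ⟨-1, m, Or.inr rfl, hroot _ (by rw [hm]; ring)⟩
  · exact ⟨1, m, Or.inl rfl, hroot _ (by rw [hm]; ring)⟩

/-- For `r = 1` and `n > 2`, some factor `u` has `|u(0)|^(n-1) = p^(deg u)`, so `n - 1` divides `deg
u` and the cofactor is linear. -/
theorem exists_int_root_of_not_irreducible (hp : p.Prime) (hn : 2 ≤ n)
    (hε₁ : ε₁ = 1 ∨ ε₁ = -1) (hε₂ : ε₂ = 1 ∨ ε₂ = -1) (h : n = 2 ∨ (r = 1 ∧ 2 ≤ k))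
    (hirr : ¬ Irreducible (primePowerTrinomial p n r k ε₁ ε₂)) :
    ∃ (s : ℤ) (j : ℕ), (s = 1 ∨ s = -1) ∧
      (s * (p : ℤ) ^ j) ^ n + p ^ r * ε₁ * (s * (p : ℤ) ^ j) + p ^ k * ε₂ = 0 := by
  have : Fact p.Prime := ⟨hp⟩
  obtain ⟨g, q, hg, hq, hg1, hq1, hgq⟩ := exists_monic_factors hn hirr
  have hdeg : g.natDegree + q.natDegree = n := by
    rw [← hg.natDegree_mul hq, hgq, primePowerTrinomial_natDegree hn]
  have hgd : g.natDegree ≠ 0 := fun h => hg1 (hg.natDegree_eq_zero.1 h)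
  have hqd : q.natDegree ≠ 0 := fun h => hq1 (hq.natDegree_eq_zero.1 h)
  have hgf : g ∣ primePowerTrinomial p n r k ε₁ ε₂ := Dvd.intro _ hgq
  have hqf : q ∣ primePowerTrinomial p n r k ε₁ ε₂ := Dvd.intro_left _ hgq
  by_cases hn2 : n = 2
  · exact exists_int_root_of_natDegree_eq_one hp hn hε₂ hg (by omega) hgf
  obtain ⟨rfl, hk⟩ := h.resolve_left hn2
  have key : ∀ u : ℤ[X], u ∣ primePowerTrinomial p n 1 k ε₁ ε₂ → u.natDegree ≠ 0 →
      |(u.coeff 0 : ℝ)| ^ (n - 1) = ((p : ℝ) ^ 1) ^ u.natDegree → n - 1 ≤ u.natDegree := by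
    intro u hud hu0 hu
    obtain ⟨m, hm⟩ := coeff_zero_eq_of_dvd hp hn hε₂ hud
    have h3 : |(u.coeff 0 : ℝ)| = (p : ℝ) ^ m := by
      rcases hm with hm | hm <;> rw [hm] <;> simp
    rw [h3, pow_one, ← pow_mul] at hu
    have h4 : p ^ (m * (n - 1)) = p ^ u.natDegree := by exact_mod_cast hu
    have h5 := Nat.pow_right_injective hp.two_le h4
    rw [← h5]
    refine Nat.le_mul_of_pos_left _ (Nat.pos_of_ne_zero ?_)
    rintro rfl
    simp at h5
    exact hu0 h5.symm
  have hlt : 1 * n < k * (n - 1) := by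
    have : 2 * (n - 1) ≤ k * (n - 1) := Nat.mul_le_mul_right _ hk
    omega
  rcases abs_coeff_zero_pow_eq_or_of_lt hn hε₁ hε₂ hlt hg hq hgq.dvd with h' | h'
  · have := key g hgf hgd h'
    exact exists_int_root_of_natDegree_eq_one hp hn hε₂ hq (by omega) hqf
  · have := key q hqf hqd h'
    exact exists_int_root_of_natDegree_eq_one hp hn hε₂ hg (by omega) hgf

theorem irreducible_of_linear_coeff_prime (hp : p.Prime) (hn : 2 ≤ n) (hk : 2 ≤ k)
    (hε₁ : ε₁ = 1 ∨ ε₁ = -1) (hε₂ : ε₂ = 1 ∨ ε₂ = -1)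
    (h2 : primePowerTrinomial p n 1 k ε₁ ε₂ ≠ X ^ 2 + C (2 * ε₁) * X - C 8)
    (h3 : primePowerTrinomial p n 1 k ε₁ ε₂ ≠ X ^ 3 - C 2 * X + C (4 * ε₂)) :
    Irreducible (primePowerTrinomial p n 1 k ε₁ ε₂) := by
  by_contra hirr
  obtain ⟨s, j, hs, hx⟩ :=
    exists_int_root_of_not_irreducible hp hn hε₁ hε₂ (Or.inr ⟨rfl, hk⟩) hirr
  have hunit : ∀ x y : ℤ, (x = 1 ∨ x = -1) → (y = 1 ∨ y = -1) → (x * y = 1 ∨ x * y = -1) := by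
    rintro x y (rfl | rfl) (rfl | rfl) <;> simp
  have hsn : s ^ n = 1 ∨ s ^ n = -1 := by
    rcases hs with rfl | rfl
    · simp
    · exact neg_one_pow_eq_or ℤ n
  have hsum : s ^ n * (p : ℤ) ^ (j * n) + (ε₁ * s) * (p : ℤ) ^ (j + 1) + ε₂ * (p : ℤ) ^ k = 0 := by
    rw [← hx]
    ring
  obtain ⟨rfl, hcase⟩ := hp.signed_pow_sum_eq_zero hsn (hunit _ _ hε₁ hs) hε₂ hsum
  -- The exponents are `jn`, `j + 1`, `k`: two agree and the third is one larger, so `j(n-1)` is 1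
  -- or 2.
  have hnk : (n = 2 ∧ k = 3) ∨ (n = 3 ∧ k = 2 ∧ j = 1) := by
    have hj : j ≤ 2 := by
      by_contra! hj
      have : j * 2 ≤ j * n := Nat.mul_le_mul_left _ hn
      omega
    interval_cases j
    · omega
    · omega
    · omega
  rcases hnk with ⟨rfl, rfl⟩ | ⟨rfl, rfl, rfl⟩
  · have he : ε₂ = -1 := by
      rcases hε₂ with rfl | h
      · exfalso
        generalize s * ((2 : ℕ) : ℤ) ^ j = x at hx
        rcases hε₁ with rfl | rfl <;> push_cast at hx
        · nlinarith [sq_nonneg (x + 1)]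
        · nlinarith [sq_nonneg (x - 1)]
      · exact h
    subst he
    apply h2
    rw [primePowerTrinomial, sub_eq_add_neg, ← C_neg]
    norm_num
  · have he : ε₁ = -1 := by
      refine hε₁.resolve_left ?_
      rintro rfl
      rcases hs with rfl | rfl <;> rcases hε₂ with rfl | rfl <;> norm_num at hx
    subst he
    apply h3
    rw [primePowerTrinomial, sub_eq_add_neg, ← neg_mul, ← C_neg]
    norm_num

theorem irreducible_of_const_coeff_prime (hp : p.Prime) (hn : 2 ≤ n) (hr : 1 ≤ r)
    (hε₂ : ε₂ = 1 ∨ ε₂ = -1) : Irreducible (primePowerTrinomial p n r 1 ε₁ ε₂) := by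
  have hpi := Nat.prime_iff_prime_int.1 hp
  have hE : (primePowerTrinomial p n r 1 ε₁ ε₂).IsEisensteinAt (Ideal.span {(p : ℤ)}) := by
    refine ⟨?_, fun {i} hi => ?_, ?_⟩
    · rw [primePowerTrinomial_monic hn, Ideal.mem_span_singleton]
      exact fun h => hpi.not_isUnit (isUnit_of_dvd_one h)
    · rw [primePowerTrinomial_natDegree hn] at hi
      rw [Ideal.mem_span_singleton, primePowerTrinomial, coeff_add, coeff_add, coeff_X_pow,
        if_neg hi.ne, zero_add, coeff_C_mul, coeff_C]
      refine dvd_add (((dvd_pow_self _ (by omega)).mul_right _).mul_right _) ?_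
      split_ifs
      · exact (dvd_pow_self _ one_ne_zero).mul_right _
      · exact dvd_zero _
    · rw [primePowerTrinomial_coeff_zero hn, pow_one, Ideal.span_singleton_pow,
        Ideal.mem_span_singleton]
      intro h
      have h1 : (p : ℤ) ^ 2 ∣ p := by
        rcases hε₂ with rfl | rfl
        · simpa using h
        · simpa using h
      obtain ⟨c, hc⟩ := h1
      have h2 : (p : ℤ) * 1 = p * (p * c) := by rw [mul_one, ← mul_assoc, ← sq, ← hc]
      exact hpi.not_isUnit (isUnit_of_dvd_one (Dvd.intro c (mul_left_cancel₀ hpi.ne_zero h2).symm))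
  exact hE.irreducible ((Ideal.span_singleton_prime hpi.ne_zero).2 hpi)
    (primePowerTrinomial_monic hn).isPrimitive
    (by rw [primePowerTrinomial_natDegree hn]; omega)

/-! ### Case analysis and conclusion -/

theorem exists_cyclotomic_factorization (hp : p.Prime) (hn : 2 ≤ n)
    (hε₁ : ε₁ = 1 ∨ ε₁ = -1) (hε₂ : ε₂ = 1 ∨ ε₂ = -1)
    (hrk : r = 0 ∨ r = 1 ∨ k = 0 ∨ k = 1)
    (h2 : primePowerTrinomial p n r k ε₁ ε₂ ≠ X ^ 2 + C (2 * ε₁) * X - C 8)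
    (h3 : primePowerTrinomial p n r k ε₁ ε₂ ≠ X ^ 3 - C 2 * X + C (4 * ε₂))
    (hirr : ¬ Irreducible (primePowerTrinomial p n r k ε₁ ε₂)) :
    ∃ fc fn : ℤ[X], primePowerTrinomial p n r k ε₁ ε₂ = fc * fn ∧
      IsCyclotomicProduct fc ∧ (fn = 1 ∨ (Irreducible fn ∧ ¬ IsReciprocalPoly fn)) := by
  have hp2 := hp.two_le
  have hpow : ∀ e : ℕ, 1 ≤ e → p ^ e ≤ 2 → p = 2 ∧ e = 1 := by
    intro e he h
    have h1 : p ^ 1 ≤ p ^ e := Nat.pow_le_pow_right hp.pos he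
    rw [pow_one] at h1
    obtain rfl : p = 2 := by omega
    refine ⟨rfl, ?_⟩
    have := (Nat.pow_le_pow_iff_right (a := 2) one_lt_two).1 (h.trans_eq (pow_one 2).symm)
    omega
  rcases Nat.eq_zero_or_pos r with rfl | hr
  · rcases Nat.eq_zero_or_pos k with rfl | hk
    · have hf : primePowerTrinomial p n 0 0 ε₁ ε₂ = X ^ n + C ε₁ * X + C ε₂ := by
        simp [primePowerTrinomial]
      have hm := primePowerTrinomial_monic (p := p) (r := 0) (k := 0) (ε₁ := ε₁) (ε₂ := ε₂) hn
      rw [hf] at hirr hm ⊢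
      exact exists_factorization_of_unit_trinomial hn hε₁ hε₂ hm hirr
    · by_cases hpk : p ^ k ≤ 2
      · obtain ⟨rfl, rfl⟩ := hpow k hk hpk
        obtain ⟨fc, fn, h1, h2, h3⟩ := exists_factorization_of_const_two hn hε₁ hε₂ hirr
        exact ⟨fc, fn, h1, h2, Or.inr h3⟩
      · refine absurd (irreducible_of_pow_lt hp hn hε₁ hε₂ ?_) hirr
        rw [zero_mul, pow_zero, mul_one, pow_mul]
        exact Nat.pow_lt_pow_left (by omega) (by omega)
  rcases Nat.eq_zero_or_pos k with rfl | hk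
  · by_cases hpr : p ^ r ≤ 2
    · obtain ⟨rfl, rfl⟩ := hpow r hr hpr
      by_cases hn2 : n = 2
      · subst hn2
        by_cases he : ε₂ = 1
        -- Here `f = (x + ε₁)²`, the double root excluded from the case `n ≥ 3`.
        · refine ⟨(X - C (-ε₁)) * (X - C (-ε₁)), 1, ?_, ?_, Or.inl rfl⟩
          · subst he
            rcases hε₁ with rfl | rfl <;> simp [primePowerTrinomial] <;> ring
          · obtain ⟨s, hs, hs'⟩ := isCyclotomicProduct_X_sub_C (ζ := -ε₁) (by omega)
            refine ⟨s + s, fun m hm => hs m (by simpa using hm), ?_⟩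
            rw [Multiset.map_add, Multiset.prod_add, ← hs']
        · exfalso
          obtain ⟨s, j, hs, hx⟩ :=
            exists_int_root_of_not_irreducible hp hn hε₁ hε₂ (Or.inl rfl) hirr
          have hsum : (1 : ℤ) * ((2 : ℕ) : ℤ) ^ (j * 2) + (ε₁ * s) * ((2 : ℕ) : ℤ) ^ (j + 1) +
              ε₂ * ((2 : ℕ) : ℤ) ^ 0 = 0 := by
            rw [← hx]
            rcases hs with rfl | rfl <;> ring
          have := hp.signed_pow_sum_eq_zero (Or.inl rfl)
            (by rcases hε₁ with rfl | rfl <;> rcases hs with rfl | rfl <;> simp) hε₂ hsum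
          obtain rfl : j = 0 := by omega
          obtain rfl : ε₂ = -1 := by omega
          rcases hs with rfl | rfl <;> rcases hε₁ with rfl | rfl <;> norm_num at hx
      · obtain ⟨fc, fn, h1, h2, h3⟩ :=
          exists_factorization_of_linear_two (by omega) hε₁ hε₂ hirr
        exact ⟨fc, fn, h1, h2, Or.inr h3⟩
    · exact absurd (irreducible_of_mul_pred_lt hp hn hε₁ hε₂ (by omega)
        (Or.inr (by omega))) hirr
  · by_cases hk1 : k = 1
    · subst hk1
      exact absurd (irreducible_of_const_coeff_prime hp hn hr hε₂) hirr
    · obtain rfl : r = 1 := by omega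
      exact absurd (irreducible_of_linear_coeff_prime hp hn (by omega) hε₁ hε₂ h2 h3) hirr

theorem irreducible_of_mul_lt (hp : p.Prime) (hn : 2 ≤ n) (hr : 2 ≤ r)
    (hε₁ : ε₁ = 1 ∨ ε₁ = -1) (hε₂ : ε₂ = 1 ∨ ε₂ = -1)
    (h2 : primePowerTrinomial p n r k ε₁ ε₂ ≠
        X ^ 2 + C (2 ^ r * ε₁) * X - C (2 ^ (2 * r + 1)))
    (hlt : r * n < k) : Irreducible (primePowerTrinomial p n r k ε₁ ε₂) := by
  by_cases hex : n = 2 ∧ p = 2 ∧ k = 2 * r + 1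
  -- The only case where the strict bound of `irreducible_of_pow_lt` becomes equality. For `ε₂ = 1`
  -- the quadratic has negative discriminant.
  · obtain ⟨rfl, rfl, rfl⟩ := hex
    have he : ε₂ = 1 := by
      refine hε₂.resolve_right fun he => h2 ?_
      subst he
      rw [primePowerTrinomial, sub_eq_add_neg, ← C_neg]
      simp
    by_contra hirr
    obtain ⟨s, j, -, hx⟩ := exists_int_root_of_not_irreducible hp hn hε₁ hε₂ (Or.inl rfl) hirr
    generalize s * ((2 : ℕ) : ℤ) ^ j = x at hx
    subst he
    have hy : 0 < (2 : ℤ) ^ r := by positivity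
    push_cast at hx
    rw [show (2 : ℤ) ^ (2 * r + 1) = 2 * (2 ^ r) ^ 2 by ring] at hx
    rcases hε₁ with rfl | rfl
    · nlinarith [sq_nonneg (2 * x + 2 ^ r)]
    · nlinarith [sq_nonneg (2 * x - 2 ^ r)]
  · refine irreducible_of_pow_lt hp hn hε₁ hε₂ ?_
    obtain ⟨m, rfl⟩ : ∃ m, n = m + 1 := ⟨n - 1, by omega⟩
    rw [Nat.add_sub_cancel]
    have hmul : (r * (m + 1) + 1) * m ≤ k * m := Nat.mul_le_mul_right _ hlt
    by_cases hm : m = 1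
    · subst hm
      by_cases hp2 : p = 2
      · subst hp2
        rw [← pow_add]
        exact Nat.pow_lt_pow_right one_lt_two (by omega)
      · have hp3 : 2 < p := lt_of_le_of_ne hp.two_le (Ne.symm hp2)
        calc 2 ^ 1 * p ^ (r * (1 + 1)) < p * p ^ (r * (1 + 1)) := by
              rw [pow_one]
              exact Nat.mul_lt_mul_of_pos_right hp3 (pow_pos hp.pos _)
          _ = p ^ (r * (1 + 1) + 1) := (pow_succ' _ _).symm
          _ ≤ p ^ (k * 1) := Nat.pow_le_pow_right hp.pos (by omega)
    · have hr' : r * (m + 1) < r * (m + 1) * m := by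
        have : 0 < r * (m + 1) := by positivity
        nlinarith [show 2 ≤ m by omega]
      calc 2 ^ m * p ^ (r * (m + 1)) ≤ p ^ m * p ^ (r * (m + 1)) :=
            Nat.mul_le_mul_right _ (Nat.pow_le_pow_left hp.two_le _)
        _ = p ^ (m + r * (m + 1)) := (pow_add _ _ _).symm
        _ < p ^ (k * m) := Nat.pow_lt_pow_right hp.one_lt (by nlinarith)

end

theorem mainTheorem2 (p n r k : ℕ) (ε₁ ε₂ : ℤ) (hp : p.Prime) (hn : 2 ≤ n)
    (hε₁ : ε₁ = 1 ∨ ε₁ = -1) (hε₂ : ε₂ = 1 ∨ ε₂ = -1) :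
    ((r = 0 ∨ r = 1 ∨ k = 0 ∨ k = 1) →
      primePowerTrinomial p n r k ε₁ ε₂ ≠ X ^ 2 + C (2 * ε₁) * X - C 8 →
      primePowerTrinomial p n r k ε₁ ε₂ ≠ X ^ 3 - C 2 * X + C (4 * ε₂) →
      ¬ Irreducible (primePowerTrinomial p n r k ε₁ ε₂) →
      ∃ fc fn : ℤ[X], primePowerTrinomial p n r k ε₁ ε₂ = fc * fn ∧
        IsCyclotomicProduct fc ∧
        (fn = 1 ∨ (Irreducible fn ∧ ¬ IsReciprocalPoly fn))) ∧
    (2 ≤ k → 2 ≤ r →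
      primePowerTrinomial p n r k ε₁ ε₂ ≠
        X ^ 2 + C (2 ^ r * ε₁) * X - C (2 ^ (2 * r + 1)) →
      ¬ ((k : ℝ) / (n : ℝ) ≤ (r : ℝ) ∧ (r : ℝ) ≤ (k : ℝ) * ((n : ℝ) - 1)) →
      Irreducible (primePowerTrinomial p n r k ε₁ ε₂)) := by
  refine ⟨exists_cyclotomic_factorization hp hn hε₁ hε₂, fun hk hr hne hrange => ?_⟩
  rw [not_and_or, not_le, not_le] at hrange
  rcases hrange with h | h
  · rw [lt_div_iff₀ (by exact_mod_cast (by omega : 0 < n))] at h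
    exact irreducible_of_mul_lt hp hn hr hε₁ hε₂ hne (by exact_mod_cast h)
  · have hcast : ((n - 1 : ℕ) : ℝ) = (n : ℝ) - 1 := by
      rw [Nat.cast_sub (by omega), Nat.cast_one]
    rw [← hcast] at h
    exact irreducible_of_mul_pred_lt hp hn hε₁ hε₂ (by exact_mod_cast h) (Or.inl (by omega))
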